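/- Let $k\ge a\ge 1$ be integers with $k\not\equiv a\pmod 2$, and let $q$ be a complex number with $|q|<1$. Write $(x;q)_n=\prod_{j=0}^{n-1}(1-xq^j)$, $(x;q)_\infty=\prod_{j=0}^{\infty}(1-xq^j)$ and $(x_1,\dots,x_r;q)_\infty=(x_1;q)_\infty\cdots(x_r;q)_\infty$. For integers $n_1,\dots,n_{k-1}\ge 0$ put $N_i=n_i+n_{i+1}+\cdots+n_{k-1}$ for $1\le i\le k-1$ (so $n_i=N_i-N_{i+1}$ with $N_k=0$). Then $$\sum_{n_1,\dots,n_{k-1}\ge 0}\frac{q^{N_1^2+N_2^2+\cdots+N_{k-1}^2+2N_a+2N_{a+2}+\cdots+2N_{k-1}}\,(-q;q^2)_{n_{k-1}}}{(q^2;q^2)_{n_1}(q^2;q^2)_{n_2}\cdots(q^2;q^2)_{n_{k-2}}\,(q^4;q^4)_{n_{k-1}}}=\frac{(-q;q^2)_\infty\,(q^a,q^{2k+2-a},q^{2k+2};q^{2k+2})_\infty}{(q^2;q^2)_\infty},$$ where the multiple series converges absolutely. Here the linear terms $2N_i$ in the exponent run over all $i\equiv a\pmod 2$ with $a\le i\le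 k-1$. -/

import Mathlib

namespace QSeries

/-- The finite `q`-shifted factorial `(a; q)_n = ∏_{j=0}^{n-1} (1 - a q^j)`. -/
noncomputable def qPoch (a q : ℂ) (n : ℕ) : ℂ :=
  ∏ j ∈ Finset.range n, (1 - a * q ^ j)

/-- The infinite `q`-shifted factorial `(a; q)_∞ = ∏_{j=0}^∞ (1 - a q^j)`, for `|q| < 1`. -/
noncomputable def qPochInf (a q : ℂ) : ℂ :=
  ∏' j : ℕ, (1 - a * q ^ j)

/-- For `|q| < 1` the product defining `(a; q)_∞` converges, so `qPochInf` is its value. -/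
theorem hasProd_qPochInf (a q : ℂ) (hq : ‖q‖ < 1) :
    HasProd (fun j : ℕ => 1 - a * q ^ j) (qPochInf a q) := by
  have hs : Summable (fun j : ℕ => ‖-(a * q ^ j)‖) := by
    simp only [norm_neg, norm_mul, norm_pow]
    exact (summable_geometric_of_lt_one (norm_nonneg q) hq).mul_left ‖a‖
  have hm := multipliable_one_add_of_summable hs
  simp only [← sub_eq_add_neg] at hm
  exact hm.hasProd

/-- The entry `n_i` (indices start at `1`) of a tuple `n = (n_1, …, n_m)`;
it is `0` for `i` outside `{1, …, m}`. -/
def entry {m : ℕ} (n : Fin m → ℕ) (i : ℕ) : ℕ :=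
  if h : 1 ≤ i ∧ i ≤ m then n ⟨i - 1, by omega⟩ else 0

/-- `N_i = n_i + n_{i+1} + ⋯ + n_m`, the solution of `n_i = N_i - N_{i+1}`, `N_{m+1} = 0`. -/
def tail {m : ℕ} (n : Fin m → ℕ) (i : ℕ) : ℕ :=
  ∑ j ∈ Finset.Icc i m, entry n j

theorem tail_succ_top {m : ℕ} (n : Fin m → ℕ) : tail n (m + 1) = 0 := by
  simp [tail]

theorem tail_eq_entry_add {m : ℕ} (n : Fin m → ℕ) (i : ℕ) (hi : i ≤ m) :
    tail n i = entry n i + tail n (i + 1) := by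
  rw [tail, tail, Finset.Icc_add_one_left_eq_Ioc, ← Finset.sum_Ioc_add_eq_sum_Icc hi, add_comm]

/-- The exponent
`N_1^2 + ⋯ + N_{k-1}^2 + 2 N_a + 2 N_{a+2} + ⋯`, where the linear part runs over all indices
`i` with `a ≤ i ≤ k - 1` and `i ≡ a (mod 2)`; its last index is `k - 1` if `k ≢ a (mod 2)`. -/
def expo (k a : ℕ) (n : Fin (k - 1) → ℕ) : ℕ :=
  ∑ i ∈ Finset.Icc 1 (k - 1), tail n i ^ 2
    + ∑ i ∈ Finset.Icc a (k - 1) with i % 2 = a % 2, 2 * tail n i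

/-- The summand
`q^{N_1^2+⋯+N_{k-1}^2+2N_a+2N_{a+2}+⋯+2N_{k-1}} (-q;q^2)_{n_{k-1}}
  / ((q^2;q^2)_{n_1} ⋯ (q^2;q^2)_{n_{k-2}} (q^4;q^4)_{n_{k-1}})`. -/
noncomputable def summand (k a : ℕ) (q : ℂ) (n : Fin (k - 1) → ℕ) : ℂ :=
  q ^ expo k a n * qPoch (-q) (q ^ 2) (entry n (k - 1)) /
    ((∏ i ∈ Finset.Icc 1 (k - 2), qPoch (q ^ 2) (q ^ 2) (entry n i)) *
      qPoch (q ^ 4) (q ^ 4) (entry n (k - 1)))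

end QSeries

/-!
The proof is a Bailey chain in base `Q = q^2`. Write `K_r(n) = 1 / ((Q; Q)_{n-r} (Q; Q)_{n+r})`,
which is `0` for `|r| > n` (`kern`). Truncate the multiple sum to `N_1 ≤ N` with the extra factor
`1 / (Q; Q)_{N - N_1}`; it is then computed from the inside out by iterating
`B ↦ ∑_s w(s) B_s / (Q; Q)_{N-s}` with `w(s) = q^{s^2}` or `q^{s^2 + 2s}`, starting from
`B_s = (-q; Q)_s / (q^4; q^4)_s`. The claim is that all iterates have the shape
`B_N = (-q; Q)_N * ∑_r (-1)^r q^{A r^2 + m r} K_r(N)`, the sum being over all integers `r`.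

* At the start `A = 2` and `m = 0`, by a finite identity of Gauss
  (`tsum_thetaCoeff_two_mul_kern`).
* The weight `q^{s^2}` replaces `A` by `A + 1`. This is the Bailey lemma with one parameter equal
  to `-q`, where the factors `(-q; Q)_s` reproduce themselves; it follows termwise from
  the `q`-Chu–Vandermonde sum (`sum_kern`, `sum_thetaCoeff`).
* If `A = m + 2`, the coefficients satisfy `α_{-r-1} = -Q^{2r+1} α_r`, and then multiplication
  of the sum by `Q^s` amounts to multiplication of `α_r` by `Q^r`, because the difference is a sum
  of terms odd under `r ↦ -r-1` (`tsum_mul_zpow_mul_kern`). So the weight `q^{s^2 + 2s}` replaces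
  `(A, m)` by `(A + 1, m + 2)` (`sum_thetaCoeff_linear`), and a step with weight `q^{s^2}` restores
  `A = m + 2`.

Since `k` and `a` have opposite parity, the linear terms sit at `k - 1, k - 3, …, a`, exactly
where the second kind of step is available, and the chain ends with `A = k + 1` and
`m = k + 1 - a` (`iteratedSum_weight`). Letting `N → ∞` by dominated convergence
turns `K_r(N)` into `1 / (Q; Q)_∞^2`, and the remaining theta series is evaluated by the Jacobi
triple product (`jacobi_triple_product`), which is itself the limit of a
finite identity for the same kernel (`tsum_triple_product_kern`). Negative powers of `q` occur along
the way, so `q = 0` is checked directly.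
-/

open Filter Topology

namespace QSeries

/-! ### Finite and infinite `q`-shifted factorials -/

@[simp] theorem qPoch_zero (a p : ℂ) : qPoch a p 0 = 1 := by simp [qPoch]

theorem qPoch_succ (a p : ℂ) (n : ℕ) : qPoch a p (n + 1) = qPoch a p n * (1 - a * p ^ n) := by
  simp [qPoch, Finset.prod_range_succ]

theorem qPoch_add (a p : ℂ) (m n : ℕ) :
    qPoch a p (m + n) = qPoch a p m * qPoch (a * p ^ m) p n := by
  simp [qPoch, Finset.prod_range_add, pow_add, mul_assoc]

theorem qPoch_succ' (a p : ℂ) (n : ℕ) : qPoch a p (n + 1) = (1 - a) * qPoch (a * p) p n := by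
  rw [add_comm, qPoch_add]; simp [qPoch]

theorem one_sub_ne_zero_of_norm_lt_one {x : ℂ} (hx : ‖x‖ < 1) : 1 - x ≠ 0 := by
  rw [sub_ne_zero]
  rintro rfl
  simp at hx

theorem one_sub_pow_ne_zero {p : ℂ} (hp : ‖p‖ < 1) {n : ℕ} (hn : n ≠ 0) : 1 - p ^ n ≠ 0 :=
  one_sub_ne_zero_of_norm_lt_one (by
    rw [norm_pow]; exact pow_lt_one₀ (norm_nonneg _) hp hn)

theorem qPoch_self_succ (p : ℂ) (n : ℕ) : qPoch p p (n + 1) = qPoch p p n * (1 - p ^ (n + 1)) := by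
  rw [qPoch_succ, ← pow_succ']

theorem qPoch_self_ne_zero {p : ℂ} (hp : ‖p‖ < 1) (n : ℕ) : qPoch p p n ≠ 0 := by
  induction n with
  | zero => simp
  | succ n ih =>
    rw [qPoch_self_succ]
    exact mul_ne_zero ih (one_sub_pow_ne_zero hp n.succ_ne_zero)

theorem tendsto_qPoch (a : ℂ) {p : ℂ} (hp : ‖p‖ < 1) :
    Tendsto (qPoch a p) atTop (𝓝 (qPochInf a p)) :=
  (hasProd_qPochInf a p hp).tendsto_prod_nat

theorem qPochInf_self_ne_zero {p : ℂ} (hp : ‖p‖ < 1) : qPochInf p p ≠ 0 := by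
  have h := tprod_one_add_ne_zero_of_summable (f := fun j : ℕ => -(p * p ^ j)) ?_ ?_
  · simpa only [← sub_eq_add_neg] using! h
  · intro j
    rw [← sub_eq_add_neg, ← pow_succ']
    exact one_sub_pow_ne_zero hp j.succ_ne_zero
  · simp only [norm_neg, norm_mul, norm_pow]
    exact (summable_geometric_of_lt_one (norm_nonneg p) hp).mul_left ‖p‖

/-- The summand of the `q`-Chu–Vandermonde sum of length `j + k`. -/
noncomputable def vandermondeTerm (p b d : ℂ) (x : ℕ × ℕ) : ℂ :=
  qPoch b p x.1 * (-d) ^ x.1 * p ^ (x.1.choose 2) * qPoch (b * d * p ^ x.1) p x.2 /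
    (qPoch p p x.1 * qPoch p p x.2)

theorem one_sub_pow_mul_vandermondeTerm_succ_right {p : ℂ} (hp : ‖p‖ < 1) (b d : ℂ) (j k : ℕ) :
    (1 - p ^ (k + 1)) * vandermondeTerm p b d (j, k + 1) =
      (1 - b * d * p ^ (j + k)) * vandermondeTerm p b d (j, k) := by
  simp only [vandermondeTerm]
  rw [qPoch_self_succ, qPoch_succ, pow_add p j k]
  have := one_sub_pow_ne_zero hp k.succ_ne_zero
  have := qPoch_self_ne_zero hp j
  have := qPoch_self_ne_zero hp k
  field_simp

theorem one_sub_pow_mul_vandermondeTerm_succ_left {p : ℂ} (hp : ‖p‖ < 1) (b d : ℂ) (j k : ℕ) :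
    p ^ k * (1 - p ^ (j + 1)) * vandermondeTerm p b d (j + 1, k) =
      -d * p ^ (j + k) * (1 - b) * vandermondeTerm p (b * p) d (j, k) := by
  simp only [vandermondeTerm]
  have e1 : b * d * p ^ (j + 1) = b * p * d * p ^ j := by ring
  have e2 : (j + 1).choose 2 = j.choose 2 + j := by
    rw [Nat.choose_succ_succ' j 1, Nat.choose_one_right, add_comm]
  rw [qPoch_self_succ, qPoch_succ', e1, e2, pow_add p j k, pow_add p (j.choose 2),
    pow_succ (-d)]
  have := one_sub_pow_ne_zero hp j.succ_ne_zero
  have := qPoch_self_ne_zero hp j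
  have := qPoch_self_ne_zero hp k
  field_simp

/-- The `q`-Chu–Vandermonde sum, as an identity polynomial in `b` and `d`. The induction on the
length uses the `q`-Pascal rule and needs both `b` and `b * p`. -/
theorem sum_vandermondeTerm {p : ℂ} (hp : ‖p‖ < 1) (d : ℂ) (M : ℕ) (b : ℂ) :
    ∑ x ∈ Finset.HasAntidiagonal.antidiagonal M, vandermondeTerm p b d x =
      qPoch d p M / qPoch p p M := by
  induction M generalizing b with
  | zero => simp [vandermondeTerm]
  | succ M ih =>
    have hM := one_sub_pow_ne_zero hp M.succ_ne_zero
    have hM' := qPoch_self_ne_zero hp M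
    -- `1 - p ^ (j + k) = (1 - p ^ k) + p ^ k * (1 - p ^ j)` is the `q`-Pascal rule
    have split : ∀ x ∈ Finset.HasAntidiagonal.antidiagonal (M + 1),
        (1 - p ^ (M + 1)) * vandermondeTerm p b d x = (1 - p ^ x.2) * vandermondeTerm p b d x +
          p ^ x.2 * (1 - p ^ x.1) * vandermondeTerm p b d x := by
      intro x hx
      rw [← Finset.HasAntidiagonal.mem_antidiagonal.mp hx, pow_add]
      ring
    have h1 : ∀ x ∈ Finset.HasAntidiagonal.antidiagonal M,
        (1 - p ^ (x.2 + 1)) * vandermondeTerm p b d (x.1, x.2 + 1) =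
          (1 - b * d * p ^ M) * vandermondeTerm p b d x := by
      intro x hx
      rw [one_sub_pow_mul_vandermondeTerm_succ_right hp, Finset.HasAntidiagonal.mem_antidiagonal.mp hx]
    have h2 : ∀ x ∈ Finset.HasAntidiagonal.antidiagonal M,
        p ^ x.2 * (1 - p ^ (x.1 + 1)) * vandermondeTerm p b d (x.1 + 1, x.2) =
          -d * p ^ M * (1 - b) * vandermondeTerm p (b * p) d x := by
      intro x hx
      rw [one_sub_pow_mul_vandermondeTerm_succ_left hp, Finset.HasAntidiagonal.mem_antidiagonal.mp hx]
    have key : (1 - p ^ (M + 1)) *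
        ∑ x ∈ Finset.HasAntidiagonal.antidiagonal (M + 1), vandermondeTerm p b d x =
          (1 - d * p ^ M) * (qPoch d p M / qPoch p p M) := by
      rw [Finset.mul_sum, Finset.sum_congr rfl split, Finset.sum_add_distrib,
        Finset.Nat.sum_antidiagonal_succ', Finset.Nat.sum_antidiagonal_succ]
      simp only [pow_zero, sub_self, zero_mul, mul_zero, zero_add]
      rw [Finset.sum_congr rfl h1, Finset.sum_congr rfl h2, ← Finset.mul_sum, ← Finset.mul_sum,
        ih, ih]
      ring
    rw [← mul_right_inj' hM, key, qPoch_self_succ, qPoch_succ]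
    field_simp

/-! ### Reciprocal factorials and the kernel of a bilateral Bailey pair -/

/-- `1 / (p; p)_n` for an integer index `n`, with the natural value `0` when `n < 0`. -/
noncomputable def invPoch (p : ℂ) (n : ℤ) : ℂ :=
  if 0 ≤ n then (qPoch p p n.toNat)⁻¹ else 0

theorem invPoch_natCast (p : ℂ) (n : ℕ) : invPoch p n = (qPoch p p n)⁻¹ := by
  simp [invPoch]

theorem invPoch_of_neg (p : ℂ) {n : ℤ} (hn : n < 0) : invPoch p n = 0 := by
  simp [invPoch, hn]

/-- The recurrence of `1 / (p; p)_n`; with the convention at negative indices it holds for all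
integers. -/
theorem one_sub_zpow_mul_invPoch {p : ℂ} (hp : ‖p‖ < 1) (n : ℤ) :
    (1 - p ^ n) * invPoch p n = invPoch p (n - 1) := by
  rcases lt_trichotomy n 0 with h | rfl | h
  · rw [invPoch_of_neg p h, invPoch_of_neg p (by omega), mul_zero]
  · rw [invPoch_of_neg p (n := 0 - 1) (by omega)]; simp
  · obtain ⟨m, rfl⟩ : ∃ m : ℕ, n = (m + 1 : ℕ) := ⟨n.toNat - 1, by omega⟩
    have e : ((m + 1 : ℕ) : ℤ) - 1 = m := by push_cast; ring
    rw [e, invPoch_natCast, invPoch_natCast, qPoch_self_succ, zpow_natCast]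
    have := one_sub_pow_ne_zero hp m.succ_ne_zero
    have := qPoch_self_ne_zero hp m
    field_simp

theorem tendsto_invPoch {p : ℂ} (hp : ‖p‖ < 1) :
    Tendsto (invPoch p) atTop (𝓝 (qPochInf p p)⁻¹) := by
  have h := ((tendsto_qPoch p hp).inv₀ (qPochInf_self_ne_zero hp)).comp
    (tendsto_atTop_atTop.mpr fun b : ℕ => ⟨(b : ℤ), fun a h => by omega⟩ :
      Tendsto Int.toNat atTop atTop)
  refine h.congr' ?_
  filter_upwards [eventually_ge_atTop 0] with n hn
  simp [invPoch, hn]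

theorem tendsto_natCast_add (r : ℤ) : Tendsto (fun n : ℕ => (n : ℤ) + r) atTop atTop :=
  tendsto_atTop_add_const_right _ _ tendsto_natCast_atTop_atTop

theorem exists_norm_qPoch_le (a : ℂ) {p : ℂ} (hp : ‖p‖ < 1) : ∃ C, ∀ n, ‖qPoch a p n‖ ≤ C := by
  obtain ⟨C, hC⟩ := (Metric.isBounded_range_of_tendsto _ (tendsto_qPoch a hp)).exists_norm_le
  exact ⟨C, fun n => hC _ ⟨n, rfl⟩⟩

theorem exists_norm_invPoch_le {p : ℂ} (hp : ‖p‖ < 1) : ∃ C, ∀ n, ‖invPoch p n‖ ≤ C := by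
  obtain ⟨C, hC⟩ := (Metric.isBounded_range_of_tendsto _
    ((tendsto_invPoch hp).comp tendsto_natCast_atTop_atTop)).exists_norm_le
  refine ⟨C, fun n => ?_⟩
  rcases lt_or_ge n 0 with h | h
  · rw [invPoch_of_neg p h, norm_zero]
    exact (norm_nonneg _).trans (hC _ ⟨0, rfl⟩)
  · exact hC _ ⟨n.toNat, by simp [h]⟩

/-- The kernel `1 / ((p; p)_{n-r} (p; p)_{n+r})`, which vanishes for `|r| > n`. A sequence
`β_n = ∑_r α_r * kern p n r` over all integers `r` forms a bilateral Bailey pair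
with `α`, relative to `1`. -/
noncomputable def kern (p : ℂ) (n : ℕ) (r : ℤ) : ℂ := invPoch p (n - r) * invPoch p (n + r)

theorem kern_neg (p : ℂ) (n : ℕ) (r : ℤ) : kern p n (-r) = kern p n r := by
  rw [kern, kern, sub_neg_eq_add, ← sub_eq_add_neg, mul_comm]

theorem kern_eq_zero (p : ℂ) {n : ℕ} {r : ℤ} (h : r ∉ Finset.Icc (-(n : ℤ)) n) :
    kern p n r = 0 := by
  rw [Finset.mem_Icc, not_and_or, not_le, not_le] at h
  rcases h with h | h
  · rw [kern, invPoch_of_neg p (n := n + r) (by omega), mul_zero]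
  · rw [kern, invPoch_of_neg p (n := n - r) (by omega), zero_mul]

theorem summable_mul_kern (p : ℂ) (n : ℕ) (α : ℤ → ℂ) : Summable fun r => α r * kern p n r :=
  summable_of_ne_finset_zero (s := Finset.Icc (-(n : ℤ)) n) fun r hr => by
    rw [kern_eq_zero p hr, mul_zero]

theorem kern_zero_left (p : ℂ) (r : ℤ) : kern p 0 r = if r = 0 then 1 else 0 := by
  split_ifs with h
  · simp [h, kern, invPoch]
  · exact kern_eq_zero p (by simpa using h)

theorem kern_pred {p : ℂ} (hp : ‖p‖ < 1) (n : ℕ) (r : ℤ) :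
    kern p n r = (1 - p ^ ((n : ℤ) + 1 - r)) * (1 - p ^ ((n : ℤ) + 1 + r)) * kern p (n + 1) r := by
  have h1 := one_sub_zpow_mul_invPoch hp ((n : ℤ) + 1 - r)
  have h2 := one_sub_zpow_mul_invPoch hp ((n : ℤ) + 1 + r)
  rw [show (n : ℤ) + 1 - r - 1 = n - r by ring] at h1
  rw [show (n : ℤ) + 1 + r - 1 = n + r by ring] at h2
  rw [kern, kern, ← h1, ← h2]
  push_cast
  ring

/-- Termwise passage to the limit `n → ∞` in a Bailey pair. -/
theorem tendsto_tsum_mul_kern {p : ℂ} (hp : ‖p‖ < 1) {α : ℤ → ℂ} (hα : Summable fun r => ‖α r‖) :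
    Tendsto (fun n => ∑' r, α r * kern p n r) atTop
      (𝓝 ((∑' r, α r) * ((qPochInf p p)⁻¹ * (qPochInf p p)⁻¹))) := by
  obtain ⟨C, hC⟩ := exists_norm_invPoch_le hp
  rw [← tsum_mul_right]
  refine tendsto_tsum_of_dominated_convergence (hα.mul_right (C * C)) (fun r => ?_)
    (Eventually.of_forall fun n r => ?_)
  · have h1 := (tendsto_invPoch hp).comp (tendsto_natCast_add (-r))
    have h2 := (tendsto_invPoch hp).comp (tendsto_natCast_add r)
    exact (h1.mul h2).const_mul _
  · rw [norm_mul, kern, norm_mul]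
    gcongr
    · exact (norm_nonneg _).trans (hC 0)
    · exact hC _
    · exact hC _

/-! ### Transformations of bilateral Bailey pairs -/

/-- If `α` is antisymmetric in the sense `α_{-r-1} = -p^{2r+1} α_r`, multiplying `β_n` by `p^n`
amounts to multiplying `α_r` by `p^r`: the difference is a sum over `r` of terms that change sign
under `r ↦ -r-1`. -/
theorem tsum_mul_zpow_mul_kern {p : ℂ} (hp0 : p ≠ 0) (hp : ‖p‖ < 1) {α : ℤ → ℂ}
    (hα : ∀ r, α (-1 - r) = -p ^ (2 * r + 1) * α r) (n : ℕ) :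
    ∑' r, α r * p ^ r * kern p n r = p ^ n * ∑' r, α r * kern p n r := by
  let f : ℤ → ℂ := fun r => α r * p ^ r * (invPoch p (n - r - 1) * invPoch p (n + r))
  have hf : ∀ r, f (-1 - r) = -f r := by
    intro r
    have e : p ^ (2 * r + 1) * p ^ (-1 - r) = p ^ r := by
      rw [← zpow_add₀ hp0]; congr 1; ring
    simp only [f, hα]
    rw [show (n : ℤ) - (-1 - r) - 1 = n + r by ring, show (n : ℤ) + (-1 - r) = n - r - 1 by ring,
      ← e]
    ring
  have h0 : ∑' r, f r = 0 := by
    have h := (Equiv.subLeft (-1 : ℤ)).tsum_eq f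
    simp only [Equiv.subLeft_apply, hf, tsum_neg] at h
    exact self_eq_neg.mp h.symm
  have hfe : ∀ r, f r = α r * p ^ r * kern p n r - p ^ n * (α r * kern p n r) := by
    intro r
    have e : p ^ r * p ^ ((n : ℤ) - r) = p ^ n := by
      rw [← zpow_add₀ hp0, ← zpow_natCast]; congr 1; ring
    simp only [f, kern]
    rw [← one_sub_zpow_mul_invPoch hp (n - r), ← e]
    ring
  rw [tsum_congr hfe, (summable_mul_kern p n _).tsum_sub
    ((summable_mul_kern p n _).mul_left _), tsum_mul_left, sub_eq_zero] at h0
  exact h0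

/-- The coefficient `(-1)^r q^{A r^2 + m r}` of a theta series. -/
noncomputable def thetaCoeff (q : ℂ) (A m r : ℤ) : ℂ := (-1) ^ r * q ^ (A * r ^ 2 + m * r)

theorem thetaCoeff_mul_zpow {q : ℂ} (hq0 : q ≠ 0) (A m r B l : ℤ) :
    thetaCoeff q A m r * q ^ (B * r ^ 2 + l * r) = thetaCoeff q (A + B) (m + l) r := by
  rw [thetaCoeff, thetaCoeff, mul_assoc, ← zpow_add₀ hq0]
  congr 2; ring

theorem thetaCoeff_reflect {q : ℂ} (hq0 : q ≠ 0) (m r : ℤ) :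
    thetaCoeff q (m + 2) m (-1 - r) = -(q ^ 2) ^ (2 * r + 1) * thetaCoeff q (m + 2) m r := by
  have e : (q ^ 2) ^ (2 * r + 1) = q ^ (4 * r + 2) := by
    rw [← zpow_natCast q 2, ← zpow_mul]; congr 1; push_cast; ring
  have h : (-1 : ℂ) ^ (-1 - r) = -(-1) ^ r := by
    rcases Int.even_or_odd r with h | h
    · rw [h.neg_one_zpow, (by grind : Odd (-1 - r)).neg_one_zpow]
    · rw [h.neg_one_zpow, (by grind : Even (-1 - r)).neg_one_zpow, neg_neg]
  rw [thetaCoeff, thetaCoeff, e, h, show (m + 2) * (-1 - r) ^ 2 + m * (-1 - r) =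
    4 * r + 2 + ((m + 2) * r ^ 2 + m * r) by ring, zpow_add₀ hq0 (4 * r + 2)]
  ring

/-- The bilateral form of a finite identity of Gauss. It supplies the initial Bailey pair:
`β_n = 1 / (q^4; q^4)_n` belongs to `α_r = (-1)^r q^{2 r^2}` in base `q^2`. -/
theorem tsum_thetaCoeff_two_mul_kern {q : ℂ} (hq0 : q ≠ 0) (hq : ‖q ^ 2‖ < 1) (n : ℕ) :
    ∑' r, thetaCoeff q 2 0 r * kern (q ^ 2) n r = (qPoch (q ^ 4) (q ^ 4) n)⁻¹ := by
  induction n with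
  | zero => simp [kern_zero_left, thetaCoeff]
  | succ n ih =>
    have hp0 : q ^ 2 ≠ 0 := pow_ne_zero 2 hq0
    have hp4 : q ^ 4 = (q ^ 2) ^ 2 := by ring
    set p := q ^ 2 with hp
    set α := thetaCoeff q 2 0 with hα
    have hs : ∑' r, α r * p ^ (-r) * kern p (n + 1) r = ∑' r, α r * p ^ r * kern p (n + 1) r := by
      rw [← (Equiv.neg ℤ).tsum_eq]
      refine tsum_congr fun r => ?_
      simp [hα, kern_neg, thetaCoeff, ← inv_zpow, inv_neg]
    have hL := tsum_mul_zpow_mul_kern hp0 hq (thetaCoeff_reflect hq0 0) (n + 1)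
    rw [zero_add, ← hα] at hL
    have key : ∑' r, α r * kern p n r =
        (1 - (p ^ 2) ^ (n + 1)) * ∑' r, α r * kern p (n + 1) r := by
      have e : ∀ r, α r * kern p n r = (1 + p ^ (2 * (n + 1))) * (α r * kern p (n + 1) r) -
          (p ^ (n + 1) * (α r * p ^ r * kern p (n + 1) r) +
            p ^ (n + 1) * (α r * p ^ (-r) * kern p (n + 1) r)) := by
        intro r
        rw [kern_pred hq n r]
        simp only [zpow_add₀ hp0, zpow_sub₀ hp0, zpow_natCast, zpow_one, zpow_neg]
        have := zpow_ne_zero r hp0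
        field_simp
        ring
      have s0 := summable_mul_kern p (n + 1) α
      have s1 := summable_mul_kern p (n + 1) fun r => α r * p ^ r
      have s2 := summable_mul_kern p (n + 1) fun r => α r * p ^ (-r)
      rw [tsum_congr e, (s0.mul_left _).tsum_sub ((s1.mul_left _).add (s2.mul_left _)),
        (s1.mul_left _).tsum_add (s2.mul_left _), tsum_mul_left, tsum_mul_left, tsum_mul_left, hs,
        hL]
      ring
    have hp2 : ‖p ^ 2‖ < 1 := by
      rw [norm_pow]; exact pow_lt_one₀ (norm_nonneg _) hq two_ne_zero
    have h1 := one_sub_pow_ne_zero hp2 n.succ_ne_zero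
    rw [hp4] at ih ⊢
    rw [ih] at key
    rw [qPoch_self_succ, mul_inv, key]
    field_simp

/-- With `s = R + j` this is the `q`-Chu–Vandermonde sum for `b = d = -q^{2R+1}`. -/
theorem sum_kern_natCast {q : ℂ} (hq : ‖q ^ 2‖ < 1) (N R : ℕ) :
    ∑ s ∈ Finset.range (N + 1), q ^ s ^ 2 * invPoch (q ^ 2) (N - s) *
      (qPoch (-q) (q ^ 2) s * kern (q ^ 2) s R) =
    q ^ R ^ 2 * qPoch (-q) (q ^ 2) N * kern (q ^ 2) N R := by
  rcases lt_or_ge N R with h | h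
  · rw [kern_eq_zero _ (by simp; omega), mul_zero]
    refine Finset.sum_eq_zero fun s hs => ?_
    rw [Finset.mem_range] at hs
    rw [kern_eq_zero _ (by simp; omega), mul_zero, mul_zero]
  · obtain ⟨M, rfl⟩ := Nat.exists_eq_add_of_le h
    have hv := sum_vandermondeTerm hq (-q ^ (2 * R + 1)) M (-q ^ (2 * R + 1))
    rw [Finset.Nat.sum_antidiagonal_eq_sum_range_succ_mk] at hv
    have hd : -q ^ (2 * R + 1) = -q * (q ^ 2) ^ R := by ring
    have term : ∀ j ∈ Finset.range (M + 1),
        q ^ (R + j) ^ 2 * invPoch (q ^ 2) ((R + M : ℕ) - (R + j : ℕ)) *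
          (qPoch (-q) (q ^ 2) (R + j) * kern (q ^ 2) (R + j) R) =
        q ^ R ^ 2 * qPoch (-q) (q ^ 2) R / qPoch (q ^ 2) (q ^ 2) (2 * R + M) *
          vandermondeTerm (q ^ 2) (-q ^ (2 * R + 1)) (-q ^ (2 * R + 1)) (j, M - j) := by
      intro j hj
      obtain ⟨k, rfl⟩ := Nat.exists_eq_add_of_le (Nat.lt_succ_iff.mp (Finset.mem_range.mp hj))
      have ek : j + k - j = k := by omega
      rw [kern, show ((R + (j + k) : ℕ) : ℤ) - (R + j : ℕ) = k by push_cast; ring,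
        show ((R + j : ℕ) : ℤ) - R = j by push_cast; ring,
        show ((R + j : ℕ) : ℤ) + R = (2 * R + j : ℕ) by push_cast; ring,
        invPoch_natCast, invPoch_natCast, invPoch_natCast, vandermondeTerm]
      simp only [ek]
      rw [show 2 * R + (j + k) = (2 * R + j) + k by ring, qPoch_add (q ^ 2) (q ^ 2) (2 * R + j),
        qPoch_add (-q),
        show -q ^ (2 * R + 1) * -q ^ (2 * R + 1) * (q ^ 2) ^ j =
          q ^ 2 * (q ^ 2) ^ (2 * R + j) by ring, neg_neg, hd]
      have hne := qPoch_self_ne_zero hq (2 * R + j + k)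
      rw [qPoch_add] at hne
      have hne1 := left_ne_zero_of_mul hne
      have hne2 := right_ne_zero_of_mul hne
      have := qPoch_self_ne_zero hq j
      have := qPoch_self_ne_zero hq k
      have e : q ^ (R + j) ^ 2 = q ^ R ^ 2 * (q ^ (2 * R + 1)) ^ j * (q ^ 2) ^ j.choose 2 := by
        have hc : j + j.choose 2 * 2 = j ^ 2 := by
          rw [Nat.choose_two_right, Nat.div_mul_cancel (Nat.even_mul_pred_self j).two_dvd]
          cases j with
          | zero => rfl
          | succ j => simp only [Nat.add_sub_cancel]; ring
        rw [← pow_mul, ← pow_mul, ← pow_add, ← pow_add]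
        congr 1
        linarith [hc]
      rw [e]
      field_simp
    have hzero : ∑ s ∈ Finset.range R, q ^ s ^ 2 * invPoch (q ^ 2) ((R + M : ℕ) - s) *
        (qPoch (-q) (q ^ 2) s * kern (q ^ 2) s R) = 0 := by
      refine Finset.sum_eq_zero fun s hs => ?_
      rw [Finset.mem_range] at hs
      rw [kern_eq_zero _ (by simp; omega), mul_zero, mul_zero]
    rw [add_assoc R M 1, Finset.sum_range_add, hzero, zero_add, Finset.sum_congr rfl term,
      ← Finset.mul_sum, hv, kern, show ((R + M : ℕ) : ℤ) - R = M by push_cast; ring,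
      show ((R + M : ℕ) : ℤ) + R = (2 * R + M : ℕ) by push_cast; ring,
      invPoch_natCast, invPoch_natCast, qPoch_add (-q), hd]
    field_simp

/-- The case of a single `α_r` in `sum_tsum_kern`. The factors `(-q; q^2)_s` reproduce
themselves, so the step can be iterated. -/
theorem sum_kern {q : ℂ} (hq : ‖q ^ 2‖ < 1) (N : ℕ) (r : ℤ) :
    ∑ s ∈ Finset.range (N + 1), q ^ s ^ 2 * invPoch (q ^ 2) (N - s) *
      (qPoch (-q) (q ^ 2) s * kern (q ^ 2) s r) =
    q ^ (r ^ 2) * qPoch (-q) (q ^ 2) N * kern (q ^ 2) N r := by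
  rcases Int.eq_nat_or_neg r with ⟨R, rfl | rfl⟩
  · have h := sum_kern_natCast hq N R
    rw [h]; norm_cast
  · have h := sum_kern_natCast hq N R
    simp only [kern_neg, neg_sq]
    rw [h]; norm_cast

/-- The Bailey lemma for the weight `q^{s^2}` in base `q^2`. -/
theorem sum_tsum_kern {q : ℂ} (hq : ‖q ^ 2‖ < 1) (α : ℤ → ℂ) (N : ℕ) :
    ∑ s ∈ Finset.range (N + 1), q ^ s ^ 2 * invPoch (q ^ 2) (N - s) *
      (qPoch (-q) (q ^ 2) s * ∑' r, α r * kern (q ^ 2) s r) =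
    qPoch (-q) (q ^ 2) N * ∑' r, α r * q ^ (r ^ 2) * kern (q ^ 2) N r := by
  simp only [← tsum_mul_left]
  rw [← Summable.tsum_finsetSum fun s _ => ((summable_mul_kern _ _ α).mul_left _).mul_left _]
  refine tsum_congr fun r => ?_
  rw [show qPoch (-q) (q ^ 2) N * (α r * q ^ (r ^ 2) * kern (q ^ 2) N r) =
    α r * (q ^ (r ^ 2) * qPoch (-q) (q ^ 2) N * kern (q ^ 2) N r) by ring, ← sum_kern hq,
    Finset.mul_sum]
  exact Finset.sum_congr rfl fun s _ => by ring

/-- The Bailey step with weight `q^{s^2}` on theta coefficients. -/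
theorem sum_thetaCoeff {q : ℂ} (hq0 : q ≠ 0) (hq : ‖q ^ 2‖ < 1) (A m : ℤ) (N : ℕ) :
    ∑ s ∈ Finset.range (N + 1), q ^ s ^ 2 * invPoch (q ^ 2) (N - s) *
      (qPoch (-q) (q ^ 2) s * ∑' r, thetaCoeff q A m r * kern (q ^ 2) s r) =
    qPoch (-q) (q ^ 2) N * ∑' r, thetaCoeff q (A + 1) m r * kern (q ^ 2) N r := by
  rw [sum_tsum_kern hq]
  congr 1
  refine tsum_congr fun r => ?_
  have h := thetaCoeff_mul_zpow hq0 A m r 1 0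
  rw [one_mul, zero_mul, add_zero, add_zero] at h
  rw [h]

/-- The Bailey step with weight `q^{s^2 + 2s}` on theta coefficients. It is available only when
the exponents satisfy `A = m + 2`, and then it raises `A` by one and `m` by two. -/
theorem sum_thetaCoeff_linear {q : ℂ} (hq0 : q ≠ 0) (hq : ‖q ^ 2‖ < 1) (m : ℤ) (N : ℕ) :
    ∑ s ∈ Finset.range (N + 1), q ^ (s ^ 2 + 2 * s) * invPoch (q ^ 2) (N - s) *
      (qPoch (-q) (q ^ 2) s * ∑' r, thetaCoeff q (m + 2) m r * kern (q ^ 2) s r) =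
    qPoch (-q) (q ^ 2) N * ∑' r, thetaCoeff q (m + 3) (m + 2) r * kern (q ^ 2) N r := by
  have hp0 : q ^ 2 ≠ 0 := pow_ne_zero 2 hq0
  have h := sum_thetaCoeff hq0 hq (m + 2) (m + 2) N
  rw [show m + 2 + 1 = m + 3 by ring] at h
  rw [← h]
  refine Finset.sum_congr rfl fun s _ => ?_
  have e : ∀ r, thetaCoeff q (m + 2) (m + 2) r = thetaCoeff q (m + 2) m r * (q ^ 2) ^ r := by
    intro r
    have h := thetaCoeff_mul_zpow hq0 (m + 2) m r 0 2
    rw [zero_mul, add_zero, zero_add, zpow_mul, zpow_ofNat] at h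
    exact h.symm
  simp only [e]
  rw [tsum_mul_zpow_mul_kern hp0 hq (thetaCoeff_reflect hq0 m), pow_add, pow_mul]
  ring

/-! ### The Jacobi triple product -/

/-- Finite form of the Jacobi triple product, by induction on `n`: both sides satisfy the same
first-order recurrence, seen by shifting `r` in the two terms that carry `z` and `z⁻¹`. -/
theorem tsum_triple_product_kern {h z : ℂ} (h0 : h ≠ 0) (hz : z ≠ 0) (hh : ‖h ^ 2‖ < 1) (n : ℕ) :
    (∑' r : ℤ, (-1) ^ r * h ^ (r ^ 2) * z ^ r * kern (h ^ 2) n r) * qPoch (h ^ 2) (h ^ 2) (2 * n) =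
      qPoch (h * z) (h ^ 2) n * qPoch (h * z⁻¹) (h ^ 2) n := by
  induction n with
  | zero => simp [kern_zero_left]
  | succ n ih =>
    have hp0 : h ^ 2 ≠ 0 := pow_ne_zero 2 h0
    set p := h ^ 2 with hp
    set α : ℤ → ℂ := fun r => (-1) ^ r * h ^ (r ^ 2) * z ^ r with hα
    have hup : ∀ r : ℤ, α (r - 1) * (h * z) = -(p ^ r)⁻¹ * p * α r := by
      intro r
      simp only [hα, hp]
      rw [show (r - 1) ^ 2 = r ^ 2 + (-(2 * r) + 1) by ring, zpow_add₀ h0 (r ^ 2),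
        zpow_add₀ h0 (-(2 * r)), zpow_neg, zpow_mul, zpow_sub_one₀ hz,
        zpow_sub_one₀ (by norm_num : (-1 : ℂ) ≠ 0), zpow_ofNat, zpow_one]
      have := zpow_ne_zero r hp0
      field_simp
    have hdown : ∀ r : ℤ, α (r + 1) * (h * z⁻¹) = -p ^ r * p * α r := by
      intro r
      simp only [hα, hp]
      rw [show (r + 1) ^ 2 = r ^ 2 + (2 * r + 1) by ring, zpow_add₀ h0 (r ^ 2),
        zpow_add₀ h0 (2 * r), zpow_mul, zpow_add_one₀ hz,
        zpow_add_one₀ (by norm_num : (-1 : ℂ) ≠ 0), zpow_ofNat, zpow_one]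
      field_simp
    have s := fun k => summable_mul_kern p k α
    have sup : ∑' r, α r * (h * z) * kern p n r =
        ∑' r, α r * (-(p ^ r)⁻¹ * p * ((1 - p ^ ((n : ℤ) + r)) * (1 - p ^ ((n : ℤ) + r + 1)))) *
          kern p (n + 1) r := by
      rw [← (Equiv.subRight (1 : ℤ)).tsum_eq]
      refine tsum_congr fun r => ?_
      have h1 := one_sub_zpow_mul_invPoch hh ((n : ℤ) + r)
      have h2 := one_sub_zpow_mul_invPoch hh ((n : ℤ) + r + 1)
      rw [add_sub_cancel_right] at h2
      rw [Equiv.subRight_apply, hup, kern, kern, show (n : ℤ) + (r - 1) = n + r - 1 by ring, ← h1,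
        ← h2, show (n : ℤ) - (r - 1) = (n + 1 : ℕ) - r by push_cast; ring,
        show ((n + 1 : ℕ) : ℤ) + r = n + r + 1 by push_cast; ring]
      ring
    have sdown : ∑' r, α r * (h * z⁻¹) * kern p n r =
        ∑' r, α r * (-p ^ r * p * ((1 - p ^ ((n : ℤ) - r)) * (1 - p ^ ((n : ℤ) - r + 1)))) *
          kern p (n + 1) r := by
      rw [← (Equiv.addRight (1 : ℤ)).tsum_eq]
      refine tsum_congr fun r => ?_
      have h1 := one_sub_zpow_mul_invPoch hh ((n : ℤ) - r)
      have h2 := one_sub_zpow_mul_invPoch hh ((n : ℤ) - r + 1)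
      rw [add_sub_cancel_right] at h2
      rw [Equiv.coe_addRight, hdown, kern, kern, show (n : ℤ) - (r + 1) = n - r - 1 by ring, ← h1,
        ← h2, show (n : ℤ) + (r + 1) = (n + 1 : ℕ) + r by push_cast; ring,
        show ((n + 1 : ℕ) : ℤ) - r = n - r + 1 by push_cast; ring]
      ring
    have key : (1 - h * z * p ^ n) * (1 - h * z⁻¹ * p ^ n) * ∑' r, α r * kern p n r =
        (1 - p ^ (2 * n + 1)) * (1 - p ^ (2 * n + 2)) * ∑' r, α r * kern p (n + 1) r := by
      have e : (1 - h * z * p ^ n) * (1 - h * z⁻¹ * p ^ n) * ∑' r, α r * kern p n r =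
          (1 + p ^ (2 * n + 1)) * ∑' r, α r * kern p n r -
            p ^ n * (∑' r, α r * (h * z) * kern p n r + ∑' r, α r * (h * z⁻¹) * kern p n r) := by
        have e1 : ∀ c : ℂ, ∑' r, α r * c * kern p n r = c * ∑' r, α r * kern p n r := by
          intro c
          rw [← tsum_mul_left]
          exact tsum_congr fun r => by ring
        rw [e1, e1, pow_succ, two_mul n, pow_add, hp]
        field_simp
        ring
      rw [e, sup, sdown, ← tsum_mul_left, ← (summable_mul_kern p (n + 1) _).tsum_add
        (summable_mul_kern p (n + 1) _), ← tsum_mul_left,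
        ← ((s n).mul_left _).tsum_sub
          (((summable_mul_kern p (n + 1) _).add (summable_mul_kern p (n + 1) _)).mul_left _),
        ← tsum_mul_left]
      refine tsum_congr fun r => ?_
      rw [kern_pred hh n r]
      have hr := zpow_ne_zero r hp0
      simp only [zpow_add₀ hp0, zpow_sub₀ hp0, zpow_natCast, zpow_one]
      field_simp
      ring
    rw [show 2 * (n + 1) = 2 * n + 1 + 1 by ring, qPoch_self_succ, qPoch_self_succ, qPoch_succ,
      qPoch_succ]
    linear_combination (-qPoch p p (2 * n)) * key +
      (1 - h * z * p ^ n) * (1 - h * z⁻¹ * p ^ n) * ih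

theorem jacobi_triple_product {h z : ℂ} (h0 : h ≠ 0) (hz : z ≠ 0) (hh : ‖h ^ 2‖ < 1)
    (hs : Summable fun r : ℤ => ‖(-1) ^ r * h ^ (r ^ 2) * z ^ r‖) :
    ∑' r : ℤ, (-1) ^ r * h ^ (r ^ 2) * z ^ r =
      qPochInf (h * z⁻¹) (h ^ 2) * qPochInf (h * z) (h ^ 2) * qPochInf (h ^ 2) (h ^ 2) := by
  have h1 := (tendsto_tsum_mul_kern hh hs).mul ((tendsto_qPoch (h ^ 2) hh).comp
    (tendsto_id.const_mul_atTop' two_pos))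
  have h2 := (tendsto_qPoch (h * z) hh).mul (tendsto_qPoch (h * z⁻¹) hh)
  have h3 := tendsto_nhds_unique (h1.congr fun n => tsum_triple_product_kern h0 hz hh n) h2
  have hne := qPochInf_self_ne_zero hh
  field_simp at h3
  rw [h3, div_eq_mul_inv]
  ring

/-! ### Multiple sums as iterated Bailey steps -/

theorem prod_Icc_one_succ (m : ℕ) (f : ℕ → ℂ) :
    ∏ i ∈ Finset.Icc 1 (m + 1), f i = f 1 * ∏ i ∈ Finset.Icc 1 m, f (i + 1) := by
  rw [← Finset.mul_prod_Ioc_eq_prod_Icc (by omega), ← Finset.Icc_add_one_left_eq_Ioc,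
    ← Finset.map_add_right_Icc, Finset.prod_map]
  simp

theorem entry_cons_one {m : ℕ} (x : ℕ) (n : Fin m → ℕ) :
    entry (Fin.cons x n : Fin (m + 1) → ℕ) 1 = x := by
  simp [entry]

theorem entry_cons_succ {m : ℕ} (x : ℕ) (n : Fin m → ℕ) {i : ℕ} (hi : 1 ≤ i) :
    entry (Fin.cons x n : Fin (m + 1) → ℕ) (i + 1) = entry n i := by
  obtain ⟨j, rfl⟩ := Nat.exists_eq_add_of_le' hi
  by_cases h : j + 1 ≤ m
  · rw [entry, entry, dif_pos (by omega), dif_pos (by omega)]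
    rfl
  · rw [entry, entry, dif_neg (by omega), dif_neg (by omega)]

theorem tail_cons_succ {m : ℕ} (x : ℕ) (n : Fin m → ℕ) {i : ℕ} (hi : 1 ≤ i) :
    tail (Fin.cons x n : Fin (m + 1) → ℕ) (i + 1) = tail n i := by
  rw [tail, tail, ← Finset.map_add_right_Icc, Finset.sum_map]
  exact Finset.sum_congr rfl fun j hj =>
    entry_cons_succ x n (hi.trans (Finset.mem_Icc.mp hj).1)

theorem tail_cons_one {m : ℕ} (x : ℕ) (n : Fin m → ℕ) :
    tail (Fin.cons x n : Fin (m + 1) → ℕ) 1 = x + tail n 1 := by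
  rw [tail_eq_entry_add _ _ (by omega), entry_cons_one, tail_cons_succ x n le_rfl]

theorem le_tail_one {m : ℕ} (n : Fin m → ℕ) (i : Fin m) : n i ≤ tail n 1 := by
  have h : entry n (i + 1) = n i := by
    rw [entry, dif_pos ⟨by omega, by omega⟩]
    rfl
  rw [← h]
  exact Finset.single_le_sum (f := entry n) (fun _ _ => Nat.zero_le _)
    (Finset.mem_Icc.mpr ⟨by omega, by omega⟩)

/-- The summand of an `(m + 1)`-fold sum in `n_1, …, n_{m+1}`, with weights `w i` at the partial
sums `N_i`, factors `1 / (p; p)_{n_i}` for `i ≤ m`, and a factor `c n_{m+1}`. -/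
noncomputable def multiTerm (p : ℂ) (c : ℕ → ℂ) (m : ℕ) (w : ℕ → ℕ → ℂ) (n : Fin (m + 1) → ℕ) :
    ℂ :=
  (∏ i ∈ Finset.Icc 1 (m + 1), w i (tail n i)) * (∏ i ∈ Finset.Icc 1 m, invPoch p (entry n i)) *
    c (entry n (m + 1))

theorem multiTerm_zero (p : ℂ) (c : ℕ → ℂ) (w : ℕ → ℕ → ℂ) (n : Fin 1 → ℕ) :
    multiTerm p c 0 w n = w 1 (n 0) * c (n 0) := by
  simp [multiTerm, tail, entry]

theorem multiTerm_cons (p : ℂ) (c : ℕ → ℂ) (m : ℕ) (w : ℕ → ℕ → ℂ) (x : ℕ)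
    (n : Fin (m + 1) → ℕ) :
    multiTerm p c (m + 1) w (Fin.cons x n) =
      w 1 (x + tail n 1) * invPoch p x * multiTerm p c m (fun i => w (i + 1)) n := by
  have h1 : ∏ i ∈ Finset.Icc 1 (m + 1), w (i + 1) (tail (Fin.cons x n : Fin (m + 2) → ℕ) (i + 1)) =
      ∏ i ∈ Finset.Icc 1 (m + 1), w (i + 1) (tail n i) :=
    Finset.prod_congr rfl fun i hi => by rw [tail_cons_succ x n (Finset.mem_Icc.mp hi).1]
  have h2 : ∏ i ∈ Finset.Icc 1 m, invPoch p (entry (Fin.cons x n : Fin (m + 2) → ℕ) (i + 1)) =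
      ∏ i ∈ Finset.Icc 1 m, invPoch p (entry n i) :=
    Finset.prod_congr rfl fun i hi => by rw [entry_cons_succ x n (Finset.mem_Icc.mp hi).1]
  rw [multiTerm, multiTerm, prod_Icc_one_succ (m + 1),
    prod_Icc_one_succ m fun i => invPoch p (entry (Fin.cons x n : Fin (m + 2) → ℕ) i), tail_cons_one,
    entry_cons_one, entry_cons_succ x n (Nat.le_add_left 1 m), h1, h2]
  ring

/-- The multiple sum truncated to `N_1 ≤ N` and weighted by `1 / (p; p)_{N - N_1}`, computed from
the innermost index outwards. -/
noncomputable def iteratedSum (p : ℂ) (c : ℕ → ℂ) : ℕ → (ℕ → ℕ → ℂ) → ℕ → ℂ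
  | 0, w, N => ∑ s ∈ Finset.range (N + 1), w 1 s * invPoch p (N - s) * c s
  | m + 1, w, N => ∑ s ∈ Finset.range (N + 1), w 1 s * invPoch p (N - s) *
      iteratedSum p c m (fun i => w (i + 1)) s

theorem iteratedSum_congr (p : ℂ) (c : ℕ → ℂ) (m : ℕ) : ∀ {w w' : ℕ → ℕ → ℂ},
    (∀ i, 1 ≤ i → w i = w' i) → iteratedSum p c m w = iteratedSum p c m w' := by
  induction m with
  | zero => intro w w' h; funext N; simp only [iteratedSum, h 1 le_rfl]
  | succ m ih =>
    intro w w' h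
    funext N
    simp only [iteratedSum, h 1 le_rfl]
    rw [ih fun i _ => h (i + 1) (Nat.le_add_left 1 i)]

theorem hasSum_shift_mul_invPoch (p : ℂ) (f : ℕ → ℂ) (N T : ℕ) :
    HasSum (fun x : ℕ => f (x + T) * invPoch p x * invPoch p (N - (x + T : ℕ)))
      (∑ s ∈ Finset.range (N + 1), f s * invPoch p (N - s) * invPoch p (s - T)) := by
  have h : HasSum (fun s : ℕ => f s * invPoch p (N - s) * invPoch p (s - T))
      (∑ s ∈ Finset.range (N + 1), f s * invPoch p (N - s) * invPoch p (s - T)) := by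
    refine hasSum_sum_of_ne_finset_zero fun s hs => ?_
    rw [Finset.mem_range] at hs
    rw [invPoch_of_neg p (n := N - s) (by omega), mul_zero, zero_mul]
  have hi : Function.Injective fun x : ℕ => x + T := add_left_injective T
  rw [← hi.hasSum_iff] at h
  · refine h.congr_fun fun x => ?_
    simp only [Function.comp]
    rw [show ((x + T : ℕ) : ℤ) - T = x by push_cast; ring]
    ring
  · intro s hs
    have : s < T := by
      by_contra hc
      exact hs ⟨s - T, by simp only; omega⟩
    rw [invPoch_of_neg p (n := s - T) (by omega), mul_zero]

/-- Summing over `n_1` first, with `s = N_1` as the new summation variable, peels off the outermost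
sum. The truncation `N_1 ≤ N` leaves finitely many nonzero terms. -/
theorem hasSum_multiTerm_mul_invPoch (p : ℂ) (c : ℕ → ℂ) (m : ℕ) : ∀ (w : ℕ → ℕ → ℂ) (N : ℕ),
    HasSum (fun n : Fin (m + 1) → ℕ => multiTerm p c m w n * invPoch p (N - tail n 1))
      (iteratedSum p c m w N) := by
  induction m with
  | zero =>
    intro w N
    rw [← (Equiv.funUnique (Fin 1) ℕ).symm.hasSum_iff]
    have ht : ∀ n : Fin 1 → ℕ, tail n 1 = n 0 := fun n => by simp [tail, entry]
    simp only [Function.comp_def, multiTerm_zero, ht, mul_right_comm, iteratedSum]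
    refine hasSum_sum_of_ne_finset_zero fun s hs => ?_
    rw [Finset.mem_range] at hs
    simp only [Equiv.funUnique_symm_apply, uniqueElim_const]
    rw [invPoch_of_neg p (n := N - s) (by omega), mul_zero]
  | succ m ih =>
    intro w N
    set F : (Fin (m + 2) → ℕ) → ℂ :=
      fun n => multiTerm p c (m + 1) w n * invPoch p (N - tail n 1) with hF
    have hs : Summable F := by
      refine summable_of_ne_finset_zero (s := Finset.Iic fun _ => N) fun n hn => ?_
      have : ∃ i, N < n i := by
        simpa [Pi.le_def] using hn
      obtain ⟨i, hi⟩ := this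
      have := le_tail_one n i
      rw [hF]
      simp only
      rw [invPoch_of_neg p (by omega), mul_zero]
    let e : (Fin (m + 1) → ℕ) × ℕ ≃ (Fin (m + 2) → ℕ) :=
      (Equiv.prodComm _ _).trans (Fin.consEquiv fun _ => ℕ)
    have he := e.hasSum_iff.mpr hs.hasSum
    have hfib := he.prod_fiberwise (g := fun n => ∑ s ∈ Finset.range (N + 1),
        w 1 s * invPoch p (N - s) * (multiTerm p c m (fun i => w (i + 1)) n *
          invPoch p (s - tail n 1))) fun n => by
      have h := (hasSum_shift_mul_invPoch p (w 1) N (tail n 1)).mul_right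
        (multiTerm p c m (fun i => w (i + 1)) n)
      rw [Finset.sum_mul] at h
      simp only [mul_comm (multiTerm p c m (fun i => w (i + 1)) n), ← mul_assoc]
      refine h.congr_fun fun x => ?_
      change multiTerm p c (m + 1) w (Fin.cons x n) * invPoch p (N - tail (Fin.cons x n) 1) = _
      rw [multiTerm_cons, tail_cons_one]
      ring
    have hsum : HasSum _ (iteratedSum p c (m + 1) w N) :=
      hasSum_sum fun s (_ : s ∈ Finset.range (N + 1)) =>
        (ih (fun i => w (i + 1)) s).mul_left (w 1 s * invPoch p (N - s))
    rw [hsum.unique hfib]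
    exact hs.hasSum

theorem summable_norm_multiTerm {p : ℂ} (hp : ‖p‖ < 1) {c : ℕ → ℂ} {D : ℝ}
    (hc : ∀ s, ‖c s‖ ≤ D) {ρ : ℝ} (h0 : 0 ≤ ρ) (h1 : ρ < 1) (m : ℕ) :
    ∀ {w : ℕ → ℕ → ℂ}, (∀ i s, ‖w i s‖ ≤ ρ ^ s) → Summable fun n => ‖multiTerm p c m w n‖ := by
  have hg := summable_geometric_of_lt_one h0 h1
  induction m with
  | zero =>
    intro w hw
    rw [← (Equiv.funUnique (Fin 1) ℕ).symm.summable_iff]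
    refine (hg.mul_right D).of_nonneg_of_le (fun _ => norm_nonneg _) fun x => ?_
    simp only [Function.comp, multiTerm_zero, norm_mul]
    gcongr
    · exact hw _ _
    · exact hc _
  | succ m ih =>
    intro w hw
    obtain ⟨G, hG⟩ := exists_norm_invPoch_le hp
    have hG0 : 0 ≤ G := (norm_nonneg _).trans (hG 0)
    rw [← (Fin.consEquiv fun _ => ℕ).summable_iff]
    refine ((hg.mul_right G).mul_of_nonneg (ih fun i => hw (i + 1)) (fun x => by positivity)
      fun _ => norm_nonneg _).of_nonneg_of_le (fun _ => norm_nonneg _) fun x => ?_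
    change ‖multiTerm p c (m + 1) w (Fin.cons x.1 x.2)‖ ≤ _
    rw [multiTerm_cons, norm_mul, norm_mul]
    gcongr
    · exact (hw _ _).trans (pow_le_pow_of_le_one h0 h1.le (Nat.le_add_right _ _))
    · exact hG _

/-- Letting `N → ∞` removes the truncation `N_1 ≤ N` from a multiple sum. -/
theorem tendsto_iteratedSum {p : ℂ} (hp : ‖p‖ < 1) {c : ℕ → ℂ} {m : ℕ} {w : ℕ → ℕ → ℂ}
    (hs : Summable fun n => ‖multiTerm p c m w n‖) :
    Tendsto (iteratedSum p c m w) atTop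
      (𝓝 ((∑' n, multiTerm p c m w n) * (qPochInf p p)⁻¹)) := by
  obtain ⟨C, hC⟩ := exists_norm_invPoch_le hp
  rw [← tsum_mul_right]
  refine (tendsto_tsum_of_dominated_convergence (hs.mul_right C) (fun n => ?_)
    (Eventually.of_forall fun N n => ?_)).congr
      fun N => (hasSum_multiTerm_mul_invPoch p c m w N).tsum_eq
  · exact ((tendsto_invPoch hp).comp (tendsto_natCast_add (-(tail n 1 : ℤ)))).const_mul _
  · rw [norm_mul]
    gcongr
    exact hC _

/-! ### Evaluation of the multiple sum -/

/-- The weight `q^{s^2}` or `q^{s^2 + 2s}` attached to `s = N_i`; the linear term is present for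
`i ≥ a` with `i ≡ a (mod 2)`. -/
noncomputable def weight (q : ℂ) (a i s : ℕ) : ℂ :=
  q ^ (s ^ 2 + if a ≤ i ∧ i % 2 = a % 2 then 2 * s else 0)

/-- The factor of the summand belonging to the innermost index `n_{k-1}`. -/
noncomputable def innerFactor (q : ℂ) (s : ℕ) : ℂ :=
  qPoch (-q) (q ^ 2) s * (qPoch (q ^ 4) (q ^ 4) s)⁻¹

/-- Steps with and without linear term alternate down to the index `a`, which keeps the exponents
of the theta coefficients in the range where the next step applies; the remaining steps are free of
linear terms. -/
theorem iteratedSum_weight {q : ℂ} (hq0 : q ≠ 0) (hq : ‖q ^ 2‖ < 1) (m : ℕ) :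
    ∀ (a : ℕ), 1 ≤ a → a ≤ m + 1 → (m + a) % 2 = 1 → ∀ N,
    iteratedSum (q ^ 2) (innerFactor q) m (weight q a) N =
      qPoch (-q) (q ^ 2) N *
        ∑' r, thetaCoeff q (m + 3) (m + 3 - a) r * kern (q ^ 2) N r := by
  induction m with
  | zero =>
    intro a h1 h2 _ N
    obtain rfl : a = 1 := by omega
    have h := sum_thetaCoeff_linear hq0 hq 0 N
    simp only [zero_add, tsum_thetaCoeff_two_mul_kern hq0 hq] at h
    simpa [iteratedSum, weight, innerFactor, show (3 : ℤ) - 1 = 2 by norm_num] using h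
  | succ m ih =>
    intro a h1 h2 h3 N
    rw [iteratedSum]
    -- Dropping the outermost index shifts `a` to `a - 1`; for `a = 1` the next linear term is at `2`.
    rcases h1.eq_or_lt with rfl | h1
    · rw [iteratedSum_congr (w' := weight q 2) _ _ _ fun i hi => by
        funext s
        simp only [weight]
        congr 2
        exact if_congr (by omega) rfl rfl]
      have h := sum_thetaCoeff_linear hq0 hq (m + 1) N
      simp only [ih 2 (by omega) (by omega) (by omega)]
      refine (Finset.sum_congr rfl fun s _ => ?_).trans (h.trans ?_)
      · rw [show weight q 1 1 s = q ^ (s ^ 2 + 2 * s) by simp [weight],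
          show (m : ℤ) + 3 - (2 : ℕ) = m + 1 by push_cast; ring, add_assoc (m : ℤ) 1 2]
        norm_num
      · push_cast
        ring_nf
    · rw [iteratedSum_congr (w' := weight q (a - 1)) _ _ _ fun i hi => by
        funext s
        simp only [weight]
        congr 2
        exact if_congr (by omega) rfl rfl]
      have h := sum_thetaCoeff hq0 hq (m + 3) (m + 4 - a) N
      have ha : ((a - 1 : ℕ) : ℤ) = a - 1 := by omega
      simp only [ih (a - 1) (by omega) (by omega) (by omega), ha]
      refine (Finset.sum_congr rfl fun s _ => ?_).trans (h.trans ?_)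
      · rw [show weight q a 1 s = q ^ s ^ 2 by simp [weight, h1.not_ge],
          show (m : ℤ) + 3 - (a - 1) = m + 4 - a by ring]
      · push_cast
        ring_nf

theorem summable_norm_thetaCoeff {q : ℂ} (hq0 : q ≠ 0) (hq : ‖q‖ < 1) {A m : ℤ} (h : |m| < A) :
    Summable fun r => ‖thetaCoeff q A m r‖ := by
  have hpos : 0 < ‖q‖ := norm_pos_iff.mpr hq0
  have hg := summable_geometric_of_lt_one hpos.le hq
  have hb : Summable fun r : ℤ => ‖q‖ ^ r.natAbs :=
    Summable.of_nat_of_neg (by simpa using hg) (by simpa using hg)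
  refine hb.of_nonneg_of_le (fun _ => norm_nonneg _) fun r => ?_
  rw [thetaCoeff, norm_mul, norm_zpow, norm_zpow, norm_neg, norm_one, one_zpow, one_mul,
    ← zpow_natCast ‖q‖ r.natAbs]
  refine zpow_le_zpow_right_of_le_one₀ hpos hq.le ?_
  rw [Int.natCast_natAbs]
  have h1 : |m * r| ≤ (A - 1) * |r| := by
    rw [abs_mul]; gcongr; omega
  have h2 : |r| ≤ r ^ 2 := by
    rw [← sq_abs]; exact Int.le_self_sq _
  have h3 := neg_abs_le (m * r)
  have h4 : 0 ≤ |m| := abs_nonneg m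
  nlinarith

theorem tsum_thetaCoeff {q : ℂ} (hq0 : q ≠ 0) (hq : ‖q‖ < 1) {A a : ℕ} (ha : 1 ≤ a) (haA : a ≤ A) :
    ∑' r, thetaCoeff q A (A - a) r =
      qPochInf (q ^ a) (q ^ (2 * A)) * qPochInf (q ^ (2 * A - a)) (q ^ (2 * A)) *
        qPochInf (q ^ (2 * A)) (q ^ (2 * A)) := by
  have hs := summable_norm_thetaCoeff hq0 hq (A := A) (m := A - a) (by
    rw [abs_of_nonneg (by omega)]; omega)
  have e : ∀ r, thetaCoeff q A (A - a) r = (-1) ^ r * (q ^ A) ^ (r ^ 2) * (q ^ (A - a)) ^ r := by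
    intro r
    rw [thetaCoeff, zpow_add₀ hq0, zpow_mul, zpow_mul, ← mul_assoc, ← Nat.cast_sub haA,
      zpow_natCast, zpow_natCast]
  simp only [e] at hs ⊢
  have h2 : (q ^ A) ^ 2 = q ^ (2 * A) := by rw [← pow_mul, mul_comm]
  have h3 : q ^ A * (q ^ (A - a))⁻¹ = q ^ a := by
    rw [← pow_sub₀ q hq0 (Nat.sub_le _ _)]; congr 1; omega
  have h4 : q ^ A * q ^ (A - a) = q ^ (2 * A - a) := by
    rw [← pow_add]; congr 1; omega
  rw [jacobi_triple_product (pow_ne_zero _ hq0) (pow_ne_zero _ hq0) _ hs, h2, h3, h4]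
  rw [h2, norm_pow]
  exact pow_lt_one₀ (norm_nonneg _) hq (by omega)

theorem summand_eq_multiTerm (m a : ℕ) (ha : 1 ≤ a) (q : ℂ) (n : Fin (m + 1) → ℕ) :
    summand (m + 2) a q n = multiTerm (q ^ 2) (innerFactor q) m (weight q a) n := by
  have he : expo (m + 2) a n = ∑ i ∈ Finset.Icc 1 (m + 1),
      (tail n i ^ 2 + if a ≤ i ∧ i % 2 = a % 2 then 2 * tail n i else 0) := by
    rw [Finset.sum_add_distrib, ← Finset.sum_filter]
    change _ + _ = _ + _
    congr 2
    ext i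
    simp only [Finset.mem_filter, Finset.mem_Icc]
    omega
  have hw : ∏ i ∈ Finset.Icc 1 (m + 1), weight q a i (tail n i) = q ^ expo (m + 2) a n := by
    rw [he, ← Finset.prod_pow_eq_pow_sum]
    rfl
  rw [multiTerm, hw, innerFactor]
  simp only [invPoch_natCast, Finset.prod_inv_distrib]
  change q ^ expo (m + 2) a n * qPoch (-q) (q ^ 2) (entry n (m + 1)) /
    ((∏ i ∈ Finset.Icc 1 m, qPoch (q ^ 2) (q ^ 2) (entry n i)) *
      qPoch (q ^ 4) (q ^ 4) (entry n (m + 1))) = _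
  rw [div_eq_mul_inv, mul_inv]
  ring

theorem norm_weight_le {q : ℂ} (hq : ‖q‖ < 1) (a i s : ℕ) : ‖weight q a i s‖ ≤ ‖q‖ ^ s := by
  rw [weight, norm_pow]
  exact pow_le_pow_of_le_one (norm_nonneg _) hq.le
    ((Nat.le_self_pow two_ne_zero s).trans (Nat.le_add_right _ _))

theorem exists_norm_innerFactor_le {q : ℂ} (hq : ‖q‖ < 1) : ∃ D, ∀ s, ‖innerFactor q s‖ ≤ D := by
  have hpow : ∀ n : ℕ, n ≠ 0 → ‖q ^ n‖ < 1 := fun n hn => by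
    rw [norm_pow]; exact pow_lt_one₀ (norm_nonneg _) hq hn
  obtain ⟨C, hC⟩ := exists_norm_qPoch_le (-q) (hpow 2 two_ne_zero)
  obtain ⟨G, hG⟩ := exists_norm_invPoch_le (hpow 4 four_ne_zero)
  refine ⟨C * G, fun s => ?_⟩
  rw [innerFactor, ← invPoch_natCast, norm_mul]
  gcongr
  · exact (norm_nonneg _).trans (hC 0)
  · exact hC s
  · exact hG s

/-- At `q = 0` only the term `n = 0` survives on the left, and every product on the right is
`1`. -/
theorem hasSum_summand_zero (k a : ℕ) (hk : 2 ≤ k) :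
    HasSum (fun n : Fin (k - 1) → ℕ => summand k a 0 n) 1 := by
  have h0 : summand k a 0 0 = 1 := by
    have e : ∀ i, entry (0 : Fin (k - 1) → ℕ) i = 0 := fun i => by simp [entry]
    have t : ∀ i, tail (0 : Fin (k - 1) → ℕ) i = 0 := fun i => by simp [tail, e]
    simp [summand, expo, e, t]
  rw [← h0]
  refine hasSum_single _ fun n hn => ?_
  obtain ⟨i, hi⟩ := Function.ne_iff.mp hn
  have h1 : 0 < tail n 1 := (Nat.pos_of_ne_zero hi).trans_le (le_tail_one n i)
  have h2 : tail n 1 ^ 2 ≤ expo k a n :=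
    (Finset.single_le_sum (f := fun i => tail n i ^ 2) (fun _ _ => Nat.zero_le _)
      (Finset.mem_Icc.mpr ⟨le_rfl, by omega⟩)).trans (Nat.le_add_right _ _)
  have h3 : expo k a n ≠ 0 := by
    have := pow_pos h1 2
    omega
  simp [summand, h3]

theorem qPochInf_zero_left (q : ℂ) : qPochInf 0 q = 1 := by simp [qPochInf]

theorem hasSum_multiTerm_weight {q : ℂ} (hq0 : q ≠ 0) (hq : ‖q‖ < 1) {m a : ℕ} (h1 : 1 ≤ a)
    (h2 : a ≤ m + 1) (h3 : (m + a) % 2 = 1) :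
    HasSum (multiTerm (q ^ 2) (innerFactor q) m (weight q a))
      (qPochInf (-q) (q ^ 2) *
          (qPochInf (q ^ a) (q ^ (2 * (m + 3))) *
            qPochInf (q ^ (2 * (m + 3) - a)) (q ^ (2 * (m + 3))) *
            qPochInf (q ^ (2 * (m + 3))) (q ^ (2 * (m + 3)))) /
        qPochInf (q ^ 2) (q ^ 2)) := by
  have hp : ‖q ^ 2‖ < 1 := by
    rw [norm_pow]; exact pow_lt_one₀ (norm_nonneg _) hq two_ne_zero
  obtain ⟨D, hD⟩ := exists_norm_innerFactor_le hq
  have hs := summable_norm_multiTerm hp hD (norm_nonneg q) hq m fun i s => norm_weight_le hq a i s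
  have hne := qPochInf_self_ne_zero hp
  have htheta := tsum_thetaCoeff hq0 hq (A := m + 3) h1 (by omega)
  push_cast at htheta
  have hlim := (tendsto_qPoch (-q) hp).mul (tendsto_tsum_mul_kern hp
    (summable_norm_thetaCoeff hq0 hq (A := m + 3) (m := m + 3 - a) (by
      rw [abs_of_nonneg (by omega)]; omega)))
  have heq := tendsto_nhds_unique ((tendsto_iteratedSum hp hs).congr
    (iteratedSum_weight hq0 hp m a h1 h2 h3)) hlim
  rw [htheta] at heq
  have hT : ∑' n, multiTerm (q ^ 2) (innerFactor q) m (weight q a) n = _ :=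
    (mul_inv_eq_iff_eq_mul₀ hne).mp heq
  refine hs.of_norm.hasSum_iff.mpr (hT.trans ?_)
  field_simp

end QSeries

theorem theorem1p5 (k a : ℕ) (ha : 1 ≤ a) (hak : a ≤ k) (hpar : ¬ k ≡ a [MOD 2])
    (q : ℂ) (hq : ‖q‖ < 1) :
    HasSum (fun n : Fin (k - 1) → ℕ => QSeries.summand k a q n)
      (QSeries.qPochInf (-q) (q ^ 2) *
          (QSeries.qPochInf (q ^ a) (q ^ (2 * k + 2)) *
            QSeries.qPochInf (q ^ (2 * k + 2 - a)) (q ^ (2 * k + 2)) *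
            QSeries.qPochInf (q ^ (2 * k + 2)) (q ^ (2 * k + 2))) /
        QSeries.qPochInf (q ^ 2) (q ^ 2)) := by
  have hpar' : k % 2 ≠ a % 2 := hpar
  obtain ⟨m, rfl⟩ : ∃ m, k = m + 2 := ⟨k - 2, by omega⟩
  rcases eq_or_ne q 0 with rfl | hq0
  · convert QSeries.hasSum_summand_zero (m + 2) a (by omega) using 1
    rw [zero_pow (by omega : a ≠ 0), zero_pow (by omega : 2 * (m + 2) + 2 - a ≠ 0),
      zero_pow (by omega : 2 * (m + 2) + 2 ≠ 0), zero_pow two_ne_zero, neg_zero]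
    simp [QSeries.qPochInf_zero_left]
  rw [show (fun n : Fin (m + 2 - 1) → ℕ => QSeries.summand (m + 2) a q n) =
      QSeries.multiTerm (q ^ 2) (QSeries.innerFactor q) m (QSeries.weight q a) from
      funext (QSeries.summand_eq_multiTerm m a ha q),
    show 2 * (m + 2) + 2 = 2 * (m + 3) by ring]
  exact QSeries.hasSum_multiTerm_weight hq0 hq ha (by omega) (by omega)
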